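/- A non-adaptive interactive protocol for inputs of length $n$ is a two-party protocol in which Alice holds a private input $x\in\{0,1\}^n$, Bob has no input, in each round one party sends one bit to the other, and the number of rounds $|\pi_n|$ and the order of speaking are fixed in advance; at the end Bob outputs a string $\hat x\in\{0,1\}^n$. An interactive error correcting code (iECC) is a family $\pi=\{\pi_n\}_{n\in\mathbb N}$ of such protocols. Over the binary erasure channel an online adversary may, in every round, replace the transmitted bit (of either party) by the erasure symbol $\perp$. The iECC $\pi$ is resilient to an $\alpha$ fraction of erasures if there is $n_0\in\mathbb N$ such that for all $n>n_0$, all $x\in\{0,1\}^n$ and all online attacks that erase at most $\alpha\cdot|\pi_n|$ of the bits communicated by both parties in total, Bob outputs $\hat x=x$ (with probability $1$). Theorem. For every $\epsilon>0$ there is a (deterministic) iECC over the binary erasure channel that is resilient to a $\frac{6}{11}-\epsilon$ fraction of erasures and whose communication complexity on inputs of length $n$ satisfies $|\pi_n|=O_\epsilon(n^2)$. -/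

import Mathlib

open Filter Asymptotics

namespace ErasureChannel

/-- The two parties of a protocol. -/
inductive Party where
  | alice
  | bob
  deriving DecidableEq

/-- A non-adaptive interactive protocol in which Alice holds an `n`-bit input and Bob has none.
There are `rounds` rounds; in round `t < rounds` (counted from `0`) the party `speaker t` sends one
bit. Both the number of rounds and the order of speaking are fixed in advance.

A received symbol is `some b` (the bit `b` arrived) or `none` (the bit was erased). The bit that a
party sends in round `t` depends on `t`, on the symbols the party received before round `t` (in
chronological order), and, for Alice, on her input. A sender is not told whether a bit she sent
was erased. At the end Bob outputs an `n`-bit string computed from all symbols he received. -/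
structure Protocol (n : ℕ) where
  rounds : ℕ
  speaker : ℕ → Party
  aliceBit : (Fin n → Bool) → ℕ → List (Option Bool) → Bool
  bobBit : ℕ → List (Option Bool) → Bool
  bobOutput : List (Option Bool) → (Fin n → Bool)

/-- What happened in one round: who spoke, which bit was sent, and whether it was erased. -/
structure Event where
  speaker : Party
  sent : Bool
  erased : Bool

/-- The symbol that arrives at the receiving party. -/
def Event.received (e : Event) : Option Bool :=
  if e.erased then none else some e.sent

/-- The symbols received by the party `p`, i.e. those that come from rounds in which the other
party spoke. -/
def view (p : Party) (h : List Event) : List (Option Bool) :=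
  (h.filter fun e => e.speaker ≠ p).map Event.received

/-- An online adversary: given everything that happened in the previous rounds and the bit that is
being sent in the current round, she decides whether to erase this bit (`true` means erase). -/
abbrev Adversary : Type := List Event → Bool → Bool

namespace Protocol

variable {n : ℕ}

/-- The bit sent in the round that follows the history `h`; its index is `h.length`. -/
def nextBit (π : Protocol n) (x : Fin n → Bool) (h : List Event) : Bool :=
  match π.speaker h.length with
  | Party.alice => π.aliceBit x h.length (view Party.alice h)
  | Party.bob => π.bobBit h.length (view Party.bob h)

/-- The event in the round that follows the history `h`. -/
def nextEvent (π : Protocol n) (x : Fin n → Bool) (A : Adversary) (h : List Event) : Event where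
  speaker := π.speaker h.length
  sent := π.nextBit x h
  erased := A h (π.nextBit x h)

/-- The history, in chronological order, of the first `t` rounds of the execution on Alice's input
`x` under the attack `A`. -/
def history (π : Protocol n) (x : Fin n → Bool) (A : Adversary) : ℕ → List Event
  | 0 => []
  | t + 1 => π.history x A t ++ [π.nextEvent x A (π.history x A t)]

/-- The complete execution. -/
def execution (π : Protocol n) (x : Fin n → Bool) (A : Adversary) : List Event :=
  π.history x A π.rounds

/-- The number of bits, of both parties together, that are erased in the execution. -/
def erasures (π : Protocol n) (x : Fin n → Bool) (A : Adversary) : ℕ :=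
  (π.execution x A).countP fun e => e.erased

/-- Bob's output at the end of the execution. -/
def result (π : Protocol n) (x : Fin n → Bool) (A : Adversary) : Fin n → Bool :=
  π.bobOutput (view Party.bob (π.execution x A))

end Protocol

/-- An interactive error correcting code: one protocol for each input length. -/
abbrev IECC : Type := (n : ℕ) → Protocol n

/-- `π` is resilient to an `α` fraction of erasures: for all sufficiently large `n`, every input `x`
of length `n` and every online attack that erases at most `α · |π|` of all communicated bits,
Bob outputs `x`. -/
def IECC.ResilientToErasures (π : IECC) (α : ℝ) : Prop :=
  ∃ n₀ : ℕ, ∀ n : ℕ, n₀ < n → ∀ (x : Fin n → Bool) (A : Adversary),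
    ((π n).erasures x A : ℝ) ≤ α * ((π n).rounds : ℝ) → (π n).result x A = x

end ErasureChannel

/-!
The protocol consists of `O(n)` blocks of length `O(n)`. In each block Alice speaks in `8 K` rounds
and Bob in `3 K`. Alice keeps a counter `c ≤ n` and sends `(x, c)` in a binary code of relative
distance almost `1 / 2`, until she commits to a bit, which she then repeats forever. The constant
words belong to the code too (`exists_msgCode`, by the Gilbert–Varshamov argument). Bob has four
messages of pairwise relative distance `2 / 3`: do nothing, increment the counter, commit to the
parity of the counter, commit to the bit `x c`. Three words of Alice's code fit what Bob has
received only if almost `3 / 4` of her block, that is almost `6 K` bits, are erased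
(`Fits.three_mul_le`); if exactly two fit, Bob sends a query chosen from this pair alone (`reply`),
and otherwise he sends the message to do nothing.

Suppose that two executions on different inputs look the same to Bob. Then in each block the words
of the two Alices differ and both fit, so almost `4 K` of Alice's bits are erased. Call a block good
for one of the two executions if less than almost `6 K` of Alice's bits are erased and Bob's query
gets through, for which fewer than `2 K` erasures among his bits suffice. In a block that is not
good, almost `6 K` of the `11 K` bits are erased in that execution; this is the origin of `6 / 11`.

In a good block Bob knows the exact pair of states that the two Alices are in, and his query helps
whichever of them hears it. While both counters are equal and the inputs agree up to there, they are
advanced. If they become different because only one Alice heard this, then their parities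
differ, and Bob asks for the parity; if they arrive at a position where the inputs differ, he asks
for that bit. So the two Alices commit to different bits, and once both have done so, another block
can look the same to Bob only if Alice's bits are all erased. Until an Alice commits, each block
that is good for her moves her counter or makes her commit; and the Alice who commits last sees no
further good block. Therefore at most `n + 1` blocks are good for one of the two Alices
(`Inv.next`, `Inv.le_or_le`), and the other blocks of that execution exceed the erasure budget
(`many_erasures`). Hence Bob may output any input that is compatible with what he has received and
with the budget (`exists_output`).
-/

namespace ErasureChannel

/-! ### Executions round by round -/

namespace Protocol

variable {n : ℕ}

/-- The event of round `t` in the execution on input `x` under the attack `A`. -/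
def event (π : Protocol n) (x : Fin n → Bool) (A : Adversary) (t : ℕ) : Event :=
  π.nextEvent x A (π.history x A t)

theorem history_succ (π : Protocol n) (x : Fin n → Bool) (A : Adversary) (t : ℕ) :
    π.history x A (t + 1) = π.history x A t ++ [π.event x A t] := rfl

@[simp]
theorem length_history (π : Protocol n) (x : Fin n → Bool) (A : Adversary) (t : ℕ) :
    (π.history x A t).length = t := by
  induction t with
  | zero => rfl
  | succ t ih => simp [history_succ, ih]

@[simp]
theorem event_speaker (π : Protocol n) (x : Fin n → Bool) (A : Adversary) (t : ℕ) :
    (π.event x A t).speaker = π.speaker t := by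
  simp [event, nextEvent]

theorem event_sent_of_alice (π : Protocol n) (x : Fin n → Bool) (A : Adversary) {t : ℕ}
    (h : π.speaker t = Party.alice) :
    (π.event x A t).sent = π.aliceBit x t (view Party.alice (π.history x A t)) := by
  simp [event, nextEvent, nextBit, h]

theorem event_sent_of_bob (π : Protocol n) (x : Fin n → Bool) (A : Adversary) {t : ℕ}
    (h : π.speaker t = Party.bob) :
    (π.event x A t).sent = π.bobBit t (view Party.bob (π.history x A t)) := by
  simp [event, nextEvent, nextBit, h]

theorem view_history_succ (π : Protocol n) (x : Fin n → Bool) (A : Adversary) (p : Party)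
    (t : ℕ) :
    view p (π.history x A (t + 1)) = view p (π.history x A t) ++
      if π.speaker t ≠ p then [(π.event x A t).received] else [] := by
  by_cases h : π.speaker t = p <;> simp [view, history_succ, h]

theorem length_view_history (π : Protocol n) (x : Fin n → Bool) (A : Adversary) (p : Party)
    (t : ℕ) :
    (view p (π.history x A t)).length = Nat.count (fun s => π.speaker s ≠ p) t := by
  induction t with
  | zero => rfl
  | succ t ih =>
    rw [view_history_succ, Nat.count_succ, List.length_append, ih]
    split_ifs <;> simp

/-- The number of erasures, as a sum over the rounds. -/
theorem erasures_eq_sum (π : Protocol n) (x : Fin n → Bool) (A : Adversary) :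
    π.erasures x A =
      ∑ t ∈ Finset.range π.rounds, if (π.event x A t).erased then 1 else 0 := by
  unfold erasures execution
  induction π.rounds with
  | zero => rfl
  | succ t ih =>
    rw [history_succ, List.countP_append, ih, Finset.sum_range_succ, List.countP_singleton]

end Protocol

/-- The symbol that the party `p` received in round `s`, read off from her list `l` of received
symbols: since the order of speaking is fixed, its position in `l` is the number of earlier rounds
in which the other party spoke. -/
def received (speaker : ℕ → Party) (p : Party) (l : List (Option Bool)) (s : ℕ) : Option Bool :=
  l.getD (Nat.count (fun t => speaker t ≠ p) s) none

theorem received_view_history {n : ℕ} (π : Protocol n) (x : Fin n → Bool) (A : Adversary)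
    {p : Party} {s t : ℕ} (hst : s < t) (hs : π.speaker s ≠ p) :
    received π.speaker p (view p (π.history x A t)) s = (π.event x A s).received := by
  unfold received
  induction t, hst using Nat.le_induction with
  | base =>
    rw [Protocol.view_history_succ, if_pos hs,
      List.getD_append_right _ _ _ _ (Protocol.length_view_history π x A p s).le]
    simp [Protocol.length_view_history]
  | succ t hst ih =>
    rw [Protocol.view_history_succ, List.getD_append, ih]
    rw [Protocol.length_view_history]
    exact Nat.count_strict_mono hs hst

/-! ### Binary codes of relative distance close to one half -/

/-- An exponential moment bound for the volume of a Hamming ball. -/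
theorem card_hammingBall_le (L d : ℕ) (c : Fin L → Bool) {r : ℝ} (hr : 0 ≤ r) :
    ((Finset.univ.filter fun v : Fin L → Bool => hammingDist c v < d).card : ℝ) ≤
      2 ^ L * Real.exp (L * r ^ 2 / 2 - r * (L - 2 * d)) := by
  have key : ∑ v : Fin L → Bool, Real.exp (r * (L - 2 * hammingDist c v)) =
      (2 * Real.cosh r) ^ L := by
    have h1 : ∀ v : Fin L → Bool, Real.exp (r * (L - 2 * hammingDist c v)) =
        ∏ i, (if c i ≠ v i then Real.exp (-r) else Real.exp r) := by
      intro v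
      rw [Finset.prod_ite, Finset.prod_const, Finset.prod_const, ← Real.exp_nat_mul,
        ← Real.exp_nat_mul, ← Real.exp_add]
      have h2 := Finset.card_filter_add_card_filter_not (s := (Finset.univ : Finset (Fin L)))
        (fun i => c i ≠ v i)
      rw [Finset.card_univ, Fintype.card_fin] at h2
      have h3 : ((hammingDist c v : ℕ) : ℝ) +
          ((Finset.univ.filter fun i => ¬ (c i ≠ v i)).card : ℝ) = L := by exact_mod_cast h2
      congr 1
      change _ = ((hammingDist c v : ℕ) : ℝ) * -r + _
      rw [← h3]
      ring
    have h4 := Finset.prod_univ_sum (fun _ : Fin L => (Finset.univ : Finset Bool))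
      (fun i b => if c i ≠ b then Real.exp (-r) else Real.exp r)
    rw [Fintype.piFinset_univ] at h4
    rw [Finset.sum_congr rfl fun v _ => h1 v, ← h4]
    have h5 : ∀ i, ∑ b : Bool, (if c i ≠ b then Real.exp (-r) else Real.exp r) =
        2 * Real.cosh r := by
      intro i
      rw [Real.cosh_eq]
      cases c i <;> simp <;> ring
    rw [Finset.prod_congr rfl fun i _ => h5 i]
    simp
  have h6 : (2 * Real.cosh r) ^ L ≤ 2 ^ L * Real.exp (L * r ^ 2 / 2) := by
    rw [mul_pow]
    gcongr
    calc Real.cosh r ^ L ≤ Real.exp (r ^ 2 / 2) ^ L := by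
          gcongr
          exact Real.cosh_le_exp_half_sq r
      _ = _ := by rw [← Real.exp_nat_mul]; ring_nf
  have h7 : ((Finset.univ.filter fun v : Fin L → Bool => hammingDist c v < d).card : ℝ) *
      Real.exp (r * (L - 2 * d)) ≤ (2 * Real.cosh r) ^ L := by
    rw [← key, ← nsmul_eq_mul]
    refine (Finset.card_nsmul_le_sum _ _ _ fun v hv => ?_).trans
      (Finset.sum_le_sum_of_subset_of_nonneg (Finset.filter_subset _ _)
        fun v _ _ => (Real.exp_pos _).le)
    have hv' : ((hammingDist c v : ℕ) : ℝ) ≤ d := by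
      exact_mod_cast (Finset.mem_filter.mp hv).2.le
    gcongr
  rw [Real.exp_sub, ← mul_div_assoc, le_div_iff₀ (Real.exp_pos _)]
  exact h7.trans h6

/-- The Gilbert–Varshamov argument: a maximal code of minimum distance `d` that contains a given
set `S` is so large that the balls of radius `d` around its words cover everything. -/
theorem exists_code_of_ball_bound {L d : ℕ} (hd : 0 < d) {B : ℝ} (S : Finset (Fin L → Bool))
    (hS : ∀ u ∈ S, ∀ v ∈ S, u ≠ v → d ≤ hammingDist u v)
    (hB : ∀ c : Fin L → Bool,
      ((Finset.univ.filter fun v : Fin L → Bool => hammingDist c v < d).card : ℝ) ≤ B) :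
    ∃ C : Finset (Fin L → Bool), S ⊆ C ∧
      (∀ u ∈ C, ∀ v ∈ C, u ≠ v → d ≤ hammingDist u v) ∧ (2 : ℝ) ^ L ≤ C.card * B := by
  classical
  obtain ⟨C, hC, hmax⟩ := Finset.exists_max_image
    (Finset.univ.filter fun C : Finset (Fin L → Bool) =>
      S ⊆ C ∧ ∀ u ∈ C, ∀ v ∈ C, u ≠ v → d ≤ hammingDist u v) Finset.card
    ⟨S, by simpa using hS⟩
  simp only [Finset.mem_filter, Finset.mem_univ, true_and] at hC hmax
  refine ⟨C, hC.1, hC.2, ?_⟩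
  have hcover : (Finset.univ : Finset (Fin L → Bool)) ⊆
      C.biUnion fun c => Finset.univ.filter fun v => hammingDist c v < d := by
    intro v _
    by_contra hv
    simp only [Finset.mem_biUnion, Finset.mem_filter, Finset.mem_univ, true_and, not_exists,
      not_and, not_lt] at hv
    by_cases hvC : v ∈ C
    · exact hd.not_ge (by simpa using hv v hvC)
    · have := hmax (insert v C) ⟨hC.1.trans (Finset.subset_insert _ _), by
        intro a ha b hb hab
        rcases Finset.mem_insert.mp ha with ha | ha <;>
          rcases Finset.mem_insert.mp hb with hb | hb
        · exact absurd (ha.trans hb.symm) hab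
        · rw [ha, hammingDist_comm]; exact hv b hb
        · rw [hb]; exact hv a ha
        · exact hC.2 a ha b hb hab⟩
      rw [Finset.card_insert_of_notMem hvC] at this
      omega
  have h1 := (Finset.card_le_card hcover).trans Finset.card_biUnion_le
  rw [Finset.card_univ, Fintype.card_fun, Fintype.card_bool, Fintype.card_fin] at h1
  calc (2 : ℝ) ^ L ≤ ((∑ c ∈ C, (Finset.univ.filter fun v => hammingDist c v < d).card : ℕ) : ℝ) :=
        by exact_mod_cast h1
    _ ≤ ∑ c ∈ C, B := by push_cast; exact Finset.sum_le_sum fun c _ => hB c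
    _ = C.card * B := by simp

/-- What Alice may have to say: her input together with the current value of her counter, or the
bit to which she has committed. -/
abbrev Msg (n : ℕ) : Type := ((Fin n → Bool) × Fin (n + 1)) ⊕ Bool

/-- There is a binary code of length `8 q k`, where `k = 8 q (n + 1)`, for the messages of Alice in
which a committed bit is encoded by a constant word and whose minimum distance is the fraction
`1 / 2 - 1 / (8 q)` of the length. -/
theorem exists_msgCode (n q k d : ℕ) (hq : 0 < q) (hk : k = 8 * q * (n + 1))
    (hd : d + k = 4 * (q * k)) :
    ∃ code : Msg n → ℕ → Bool, (∀ b r, r < 8 * (q * k) → code (Sum.inr b) r = b) ∧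
      ∀ u v, u ≠ v →
        d ≤ ((Finset.range (8 * (q * k))).filter fun r => code u r ≠ code v r).card := by
  classical
  set L := 8 * (q * k) with hL
  have hkpos : 0 < k := by rw [hk]; positivity
  have hkq : k ≤ q * k := Nat.le_mul_of_pos_left k hq
  have hdpos : 0 < d := by omega
  have hdL : d ≤ L := by omega
  have hqR : (0 : ℝ) < q := by exact_mod_cast hq
  have hball : ∀ c : Fin L → Bool,
      ((Finset.univ.filter fun v : Fin L → Bool => hammingDist c v < d).card : ℝ) ≤
        2 ^ L * Real.exp (-(2 * (n + 1))) := by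
    intro c
    refine (card_hammingBall_le L d c (r := 1 / (4 * q)) (by positivity)).trans (le_of_eq ?_)
    have hdR : (d : ℝ) = 4 * (q * k) - k := by
      have : (d : ℝ) + k = 4 * (q * k) := by exact_mod_cast hd
      linarith
    have hkR : (k : ℝ) = 8 * q * (n + 1) := by exact_mod_cast hk
    have hLR : (L : ℝ) = 8 * (q * k) := by exact_mod_cast hL
    congr 2
    rw [hLR, hdR, hkR]
    field_simp
    ring
  have hconst : ∀ b b' : Bool, b ≠ b' →
      hammingDist (fun _ : Fin L => b) (fun _ => b') = L := by
    intro b b' h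
    simp [hammingDist, h]
  obtain ⟨C, hSC, hC, hcard⟩ := exists_code_of_ball_bound hdpos
    (Finset.univ.image fun (b : Bool) (_ : Fin L) => b) (by
      intro u hu v hv huv
      obtain ⟨b, -, rfl⟩ := Finset.mem_image.mp hu
      obtain ⟨b', -, rfl⟩ := Finset.mem_image.mp hv
      rw [hconst b b' fun h => huv (by rw [h])]
      exact hdL) hball
  set S : Finset (Fin L → Bool) := Finset.univ.image fun (b : Bool) (_ : Fin L) => b with hS
  have hScard : S.card ≤ 2 := Finset.card_image_le.trans (by simp)
  have hCcard : 4 ^ (n + 1) ≤ C.card := by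
    have h1 : Real.exp (2 * (n + 1)) ≤ C.card := by
      rw [Real.exp_neg] at hcard
      have h2 : (2 : ℝ) ^ L * Real.exp (2 * (n + 1)) ≤ 2 ^ L * C.card := by
        have := mul_le_mul_of_nonneg_right hcard (Real.exp_pos (2 * ((n : ℝ) + 1))).le
        rwa [mul_assoc, mul_assoc, inv_mul_cancel₀ (Real.exp_pos _).ne', mul_one,
          mul_comm (C.card : ℝ)] at this
      exact le_of_mul_le_mul_left h2 (by positivity)
    have h3 : (4 : ℝ) ^ (n + 1) ≤ Real.exp (2 * (n + 1)) := by
      have h4 : (2 : ℝ) ≤ Real.exp 1 := by linarith [Real.add_one_le_exp (1 : ℝ)]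
      calc (4 : ℝ) ^ (n + 1) = 2 ^ (2 * (n + 1)) := by rw [pow_mul]; norm_num
        _ ≤ Real.exp 1 ^ (2 * (n + 1)) := by gcongr
        _ = _ := by rw [← Real.exp_nat_mul]; push_cast; ring_nf
    exact_mod_cast h3.trans h1
  have hemb : Fintype.card ((Fin n → Bool) × Fin (n + 1)) ≤
      Fintype.card {v // v ∈ C \ S} := by
    rw [Fintype.card_coe, Fintype.card_prod, Fintype.card_fun, Fintype.card_bool, Fintype.card_fin,
      Fintype.card_fin, Finset.card_sdiff_of_subset hSC]
    have h1 : n + 1 ≤ 2 ^ n := Nat.lt_two_pow_self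
    have h2 : (4 : ℕ) ^ (n + 1) = 4 * (2 ^ n * 2 ^ n) := by
      rw [pow_succ, ← mul_pow]; norm_num; ring
    have h3 : 2 ^ n * (n + 1) ≤ 2 ^ n * 2 ^ n := Nat.mul_le_mul_left _ h1
    have h4 : 1 ≤ 2 ^ n * 2 ^ n := Nat.one_le_iff_ne_zero.mpr (by positivity)
    omega
  obtain ⟨f⟩ := Function.Embedding.nonempty_of_card_le hemb
  let w : Msg n → Fin L → Bool := Sum.elim (fun p => (f p).1) fun b _ => b
  have hmem : ∀ u, w u ∈ C := by
    rintro (p | b)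
    · exact (Finset.mem_sdiff.mp (f p).2).1
    · exact hSC (Finset.mem_image.mpr ⟨b, Finset.mem_univ _, rfl⟩)
  have hLpos : 0 < L := by omega
  have hinj : Function.Injective w := by
    have hne : ∀ p b, w (Sum.inl p) ≠ w (Sum.inr b) := fun p b h =>
      (Finset.mem_sdiff.mp (f p).2).2 (Finset.mem_image.mpr ⟨b, Finset.mem_univ _, h.symm⟩)
    rintro (p | b) (p' | b') h
    · exact congrArg Sum.inl (f.injective (Subtype.ext h))
    · exact absurd h (hne p b')
    · exact absurd h.symm (hne p' b)
    · exact congrArg Sum.inr (congrFun h ⟨0, hLpos⟩)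
  refine ⟨fun u r => if h : r < L then w u ⟨r, h⟩ else false, fun b r hr => by simp [hr, w],
    fun u v huv => (hC _ (hmem u) _ (hmem v) (hinj.ne huv)).trans ?_⟩
  unfold hammingDist
  rw [← Finset.card_map Fin.valEmbedding]
  refine Finset.card_le_card fun r hr => ?_
  obtain ⟨i, hi, rfl⟩ := Finset.mem_map.mp hr
  simpa using hi

/-! ### The protocol -/

/-- The four messages of Bob. -/
inductive Query where
  /-- No request. -/
  | idle
  /-- Increment the counter. -/
  | advance
  /-- Commit to the parity of the counter. -/
  | parity
  /-- Commit to the bit of the input at the position of the counter. -/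
  | bit
  deriving DecidableEq

/-- The encoding of Bob's messages by four words with period three, any two of which differ in
two thirds of all positions. -/
def Query.word : Query → ℕ → Bool
  | idle, _ => false
  | advance, r => r % 3 ≠ 0
  | parity, r => r % 3 ≠ 1
  | bit, r => r % 3 ≠ 2

theorem Query.card_word_ne (K : ℕ) {m m' : Query} (h : m ≠ m') :
    ((Finset.range (3 * K)).filter fun r => m.word r ≠ m'.word r).card = 2 * K := by
  rw [Finset.card_filter]
  induction K with
  | zero => rfl
  | succ K ih =>
    rw [show 3 * (K + 1) = 3 * K + 1 + 1 + 1 by ring, Finset.sum_range_succ,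
      Finset.sum_range_succ, Finset.sum_range_succ, ih]
    have h0 : (3 * K) % 3 = 0 := by omega
    have h1 : (3 * K + 1) % 3 = 1 := by omega
    have h2 : (3 * K + 1 + 1) % 3 = 2 := by omega
    cases m <;> cases m' <;> simp [Query.word, h0, h1, h2] at h ⊢ <;> ring

/-- The received symbols `f 0, …, f (len - 1)` can have come from the word `w`. -/
def Fits (len : ℕ) (f : ℕ → Option Bool) (w : ℕ → Bool) : Prop :=
  ∀ r < len, ∀ b, f r = some b → b = w r

/-- The number of erasures among `f 0, …, f (len - 1)`. -/
def erasedCount (len : ℕ) (f : ℕ → Option Bool) : ℕ :=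
  ((Finset.range len).filter fun r => f r = none).card

theorem Fits.card_ne_le {len : ℕ} {f : ℕ → Option Bool} {w w' : ℕ → Bool} (h : Fits len f w)
    (h' : Fits len f w') :
    ((Finset.range len).filter fun r => w r ≠ w' r).card ≤ erasedCount len f := by
  refine Finset.card_le_card fun r hr => ?_
  rw [Finset.mem_filter, Finset.mem_range] at hr ⊢
  refine ⟨hr.1, Option.eq_none_iff_forall_ne_some.mpr fun b hb => hr.2 ?_⟩
  rw [← h r hr.1 b hb, ← h' r hr.1 b hb]

/-- Among three binary words, the positions where they do not all agree are counted twice by the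
pairwise distances. So three candidates are left only if many symbols are erased. -/
theorem Fits.three_mul_le {len d : ℕ} {f : ℕ → Option Bool} {u v w : ℕ → Bool} (hu : Fits len f u)
    (hv : Fits len f v) (hw : Fits len f w)
    (huv : d ≤ ((Finset.range len).filter fun r => u r ≠ v r).card)
    (huw : d ≤ ((Finset.range len).filter fun r => u r ≠ w r).card)
    (hvw : d ≤ ((Finset.range len).filter fun r => v r ≠ w r).card) :
    3 * d ≤ 2 * erasedCount len f := by
  have key : ((Finset.range len).filter fun r => u r ≠ v r).card +
      ((Finset.range len).filter fun r => u r ≠ w r).card +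
      ((Finset.range len).filter fun r => v r ≠ w r).card ≤ 2 * erasedCount len f := by
    unfold erasedCount
    simp only [Finset.card_filter]
    rw [← Finset.sum_add_distrib, ← Finset.sum_add_distrib, Finset.mul_sum]
    refine Finset.sum_le_sum fun r hr => ?_
    have hr' := Finset.mem_range.mp hr
    cases hf : f r with
    | none => cases u r <;> cases v r <;> cases w r <;> simp
    | some b =>
      simp [← hu r hr' b hf, ← hv r hr' b hf, ← hw r hr' b hf]
  omega

open Classical in
/-- Alice's decoding of a block of symbols from Bob: if exactly one query fits, then this query,
and otherwise `Query.idle`. -/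
noncomputable def heard (K : ℕ) (f : ℕ → Option Bool) : Query :=
  if h : ∃ m : Query, Fits (3 * K) f m.word ∧ ∀ m' : Query, Fits (3 * K) f m'.word → m' = m then
    h.choose
  else Query.idle

theorem heard_eq_or {K : ℕ} {f : ℕ → Option Bool} {m : Query} (hm : Fits (3 * K) f m.word) :
    heard K f = m ∨ heard K f = Query.idle := by
  unfold heard
  split_ifs with h
  · exact Or.inl (h.choose_spec.2 m hm).symm
  · exact Or.inr rfl

theorem heard_eq {K : ℕ} {f : ℕ → Option Bool} {m : Query} (hm : Fits (3 * K) f m.word)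
    (hf : erasedCount (3 * K) f < 2 * K) : heard K f = m := by
  have h : ∃ m : Query, Fits (3 * K) f m.word ∧ ∀ m' : Query, Fits (3 * K) f m'.word → m' = m := by
    refine ⟨m, hm, fun m' hm' => ?_⟩
    by_contra hne
    have := hm'.card_ne_le hm
    rw [Query.card_word_ne K hne] at this
    omega
  unfold heard
  rw [dif_pos h]
  exact (h.choose_spec.2 m hm).symm

/-- The state of Alice: the value of her counter, or the bit to which she has committed. -/
abbrev State (n : ℕ) : Type := Fin (n + 1) ⊕ Bool

/-- What Alice has to say on input `x` in a given state. -/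
def State.msg {n : ℕ} (x : Fin n → Bool) (s : State n) : Msg n :=
  Sum.map (fun c => (x, c)) id s

/-- The bit of the input at the position of the counter; `false` if the counter is at the end. -/
def bitAt {n : ℕ} (x : Fin n → Bool) (c : Fin (n + 1)) : Bool :=
  if h : c.val < n then x ⟨c, h⟩ else false

/-- How Alice's state changes when she hears a query. -/
def step {n : ℕ} (x : Fin n → Bool) : Query → State n → State n
  | Query.advance, Sum.inl c => Sum.inl (c + 1)
  | Query.parity, Sum.inl c => Sum.inr c.val.bodd
  | Query.bit, Sum.inl c => Sum.inr (bitAt x c)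
  | _, s => s

/-- The query that is useful when exactly two messages of Alice are possible. Two equal counters
are advanced until they point to a position where the two inputs differ. When a bit can be asked
for that has different values in the two cases, it is asked for; when Alice may have committed to
a bit already, it is one whose value in the other case is the opposite one. -/
def reply {n : ℕ} : Msg n → Msg n → Query
  | Sum.inl (x, c), Sum.inl (y, c') =>
    if c = c' then (if bitAt x c = bitAt y c then Query.advance else Query.bit) else Query.parity
  | Sum.inl (_, c), Sum.inr b => if c.val.bodd = b then Query.bit else Query.parity
  | Sum.inr b, Sum.inl (_, c) => if c.val.bodd = b then Query.bit else Query.parity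
  | Sum.inr _, Sum.inr _ => Query.idle

theorem reply_comm {n : ℕ} (u v : Msg n) : reply u v = reply v u := by
  rcases u with ⟨x, c⟩ | b <;> rcases v with ⟨y, c'⟩ | b' <;> simp only [reply]
  by_cases h : c = c'
  · subst h
    simp [eq_comm]
  · simp [h, Ne.symm h]

open Classical in
/-- Bob's query after he has received the symbols `f` from Alice: if exactly two of her messages
fit, the reply to this pair, and otherwise `Query.idle`. -/
noncomputable def query {n : ℕ} (code : Msg n → ℕ → Bool) (len : ℕ) (f : ℕ → Option Bool) :
    Query :=
  if h : ∃ p : Msg n × Msg n, {u | Fits len f (code u)} = {p.1, p.2} then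
    reply h.choose.1 h.choose.2
  else Query.idle

/-- If two messages fit, then Bob replies to them, unless so many symbols are erased that a third
message may fit, in which case he may also be idle. -/
theorem query_eq_or {n : ℕ} {code : Msg n → ℕ → Bool} {len d : ℕ} {f : ℕ → Option Bool}
    (hcode : ∀ u v, u ≠ v → d ≤ ((Finset.range len).filter fun r => code u r ≠ code v r).card)
    {u v : Msg n} (huv : u ≠ v) (hu : Fits len f (code u)) (hv : Fits len f (code v)) :
    query code len f = reply u v ∨
      (query code len f = Query.idle ∧ 3 * d ≤ 2 * erasedCount len f) := by
  unfold query
  split_ifs with h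
  · left
    have hs := h.choose_spec
    set p := h.choose
    have hu' : u ∈ ({p.1, p.2} : Set (Msg n)) := hs ▸ hu
    have hv' : v ∈ ({p.1, p.2} : Set (Msg n)) := hs ▸ hv
    rcases hu' with hu' | hu' <;> rcases hv' with hv' | hv'
    · exact absurd (hu'.trans hv'.symm) huv
    · rw [hu', hv']
    · rw [hu', hv', reply_comm]
    · exact absurd (hu'.trans hv'.symm) huv
  · refine Or.inr ⟨rfl, ?_⟩
    by_contra hlt
    refine h ⟨(u, v), Set.Subset.antisymm (fun w hw => ?_) ?_⟩
    · by_contra hne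
      simp only [Set.mem_insert_iff, Set.mem_singleton_iff, not_or] at hne
      exact hlt (hu.three_mul_le hv hw (hcode _ _ huv) (hcode _ _ (Ne.symm hne.1))
        (hcode _ _ (Ne.symm hne.2)))
    · rintro w (rfl | rfl)
      exacts [hu, hv]

/-! ### Two executions that look the same to Bob -/

/-- The relation between the states `s₀`, `s₁` of Alice in two executions on the inputs `x₀`, `x₁`
that look the same to Bob; `g₀`, `g₁` count the blocks in which she could be narrowed down to two
possibilities and the query got through. Unless the counters are equal and have not
passed a position where the inputs differ, a query or the committed bits tell the two cases apart;
and as long as one of the Alices has not committed, her counter bounds the number of her good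
blocks. -/
def Inv {n : ℕ} (x₀ x₁ : Fin n → Bool) (g₀ g₁ : ℕ) : State n → State n → Prop
  | Sum.inl c₀, Sum.inl c₁ =>
    ((c₀ = c₁ ∧ ∀ i : Fin n, i.val < c₀.val → x₀ i = x₁ i) ∨ c₀.val.bodd ≠ c₁.val.bodd) ∧
      g₀ ≤ c₀ ∧ g₁ ≤ c₁
  | Sum.inl c₀, Sum.inr b => (c₀.val.bodd ≠ b ∨ bitAt x₀ c₀ ≠ b) ∧ g₀ ≤ c₀
  | Sum.inr b, Sum.inl c₁ => (c₁.val.bodd ≠ b ∨ bitAt x₁ c₁ ≠ b) ∧ g₁ ≤ c₁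
  | Sum.inr b₀, Sum.inr b₁ => b₀ ≠ b₁ ∧ (g₀ ≤ n + 1 ∨ g₁ ≤ n + 1)

section Invariant

variable {n : ℕ} {x₀ x₁ : Fin n → Bool} {g₀ g₁ : ℕ} {s₀ s₁ : State n}

theorem Inv.msg_ne (h : Inv x₀ x₁ g₀ g₁ s₀ s₁) (hx : x₀ ≠ x₁) : s₀.msg x₀ ≠ s₁.msg x₁ := by
  rcases s₀ with c₀ | b₀ <;> rcases s₁ with c₁ | b₁ <;> simp [State.msg]
  · exact fun h' => absurd h' hx
  · exact h.1

theorem Inv.le_or_le (h : Inv x₀ x₁ g₀ g₁ s₀ s₁) : g₀ ≤ n + 1 ∨ g₁ ≤ n + 1 := by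
  rcases s₀ with c₀ | b₀ <;> rcases s₁ with c₁ | b₁
  · exact Or.inl (h.2.1.trans c₀.2.le)
  · exact Or.inl (h.2.trans c₀.2.le)
  · exact Or.inr (h.2.trans c₁.2.le)
  · exact h.2

theorem step_idle (x : Fin n → Bool) (s : State n) : step x Query.idle s = s := by
  cases s <;> rfl

theorem step_inr (x : Fin n → Bool) (m : Query) (b : Bool) :
    step x m (Sum.inr b) = Sum.inr b := by
  cases m <;> rfl

/-- The invariant survives a block in which Bob sends the reply to the pair of possible messages
and each of the two Alices either hears it or ignores it. -/
theorem Inv.next (h : Inv x₀ x₁ g₀ g₁ s₀ s₁) (hx : x₀ ≠ x₁) {m : Query}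
    (hm : m = reply (s₀.msg x₀) (s₁.msg x₁)) {s₀' s₁' : State n} {e₀ e₁ : ℕ}
    (hne : ∀ b b', s₀ = Sum.inr b → s₁ = Sum.inr b' → e₀ = 0 ∧ e₁ = 0)
    (h₀ : (s₀' = step x₀ m s₀ ∧ e₀ ≤ 1) ∨ (s₀' = s₀ ∧ e₀ = 0))
    (h₁ : (s₁' = step x₁ m s₁ ∧ e₁ ≤ 1) ∨ (s₁' = s₁ ∧ e₁ = 0)) :
    Inv x₀ x₁ (g₀ + e₀) (g₁ + e₁) s₀' s₁' := by
  rcases s₀ with c₀ | b₀ <;> rcases s₁ with c₁ | b₁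
  · obtain ⟨hc, hg₀, hg₁⟩ := h
    have hl₀ := c₀.2
    have hl₁ := c₁.2
    by_cases hcc : c₀ = c₁
    · subst hcc
      have hpre : ∀ i : Fin n, i.val < c₀.val → x₀ i = x₁ i := by
        rcases hc with hc | hc
        · exact hc.2
        · exact absurd rfl hc
      -- equal inputs are excluded, so the counter has not reached the end
      have hlt : c₀.val < n := by
        by_contra hge
        exact hx (funext fun i => hpre i (by have := i.2; omega))
      by_cases hbit : bitAt x₀ c₀ = bitAt x₁ c₀
      · have hm' : m = Query.advance := by simp [hm, State.msg, reply, hbit]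
        have hsucc : (c₀ + 1).val = c₀.val + 1 :=
          Fin.val_add_one_of_lt (by rw [Fin.lt_def, Fin.val_last]; exact hlt)
        have hpre' : ∀ i : Fin n, i.val < c₀.val + 1 → x₀ i = x₁ i := by
          intro i hi
          rcases Nat.lt_succ_iff_lt_or_eq.mp hi with hi | hi
          · exact hpre i hi
          · simp only [bitAt, dif_pos hlt] at hbit
            rwa [show i = ⟨c₀.val, hlt⟩ from Fin.ext hi]
        rcases h₀ with ⟨rfl, he₀⟩ | ⟨rfl, rfl⟩ <;> rcases h₁ with ⟨rfl, he₁⟩ | ⟨rfl, rfl⟩ <;>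
          simp only [hm', step, Inv, hsucc, Nat.bodd_succ]
        · exact ⟨Or.inl ⟨trivial, hpre'⟩, by omega, by omega⟩
        · exact ⟨Or.inr (by simp), by omega, by omega⟩
        · exact ⟨Or.inr (by simp), by omega, by omega⟩
        · exact ⟨Or.inl ⟨trivial, hpre⟩, by omega, by omega⟩
      · have hm' : m = Query.bit := by simp [hm, State.msg, reply, hbit]
        rcases h₀ with ⟨rfl, he₀⟩ | ⟨rfl, rfl⟩ <;> rcases h₁ with ⟨rfl, he₁⟩ | ⟨rfl, rfl⟩ <;>
          simp only [hm', step, Inv]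
        · exact ⟨hbit, by omega⟩
        · exact ⟨Or.inr (Ne.symm hbit), by omega⟩
        · exact ⟨Or.inr hbit, by omega⟩
        · exact ⟨Or.inl ⟨trivial, hpre⟩, by omega, by omega⟩
    · have hpar : c₀.val.bodd ≠ c₁.val.bodd := by
        rcases hc with hc | hc
        · exact absurd hc.1 hcc
        · exact hc
      have hm' : m = Query.parity := by simp [hm, State.msg, reply, hcc]
      rcases h₀ with ⟨rfl, he₀⟩ | ⟨rfl, rfl⟩ <;> rcases h₁ with ⟨rfl, he₁⟩ | ⟨rfl, rfl⟩ <;>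
        simp only [hm', step, Inv]
      · exact ⟨hpar, by omega⟩
      · exact ⟨Or.inl hpar.symm, by omega⟩
      · exact ⟨Or.inl hpar, by omega⟩
      · exact ⟨Or.inr hpar, by omega, by omega⟩
  · have hl₀ := c₀.2
    obtain ⟨hc, hg₀⟩ := h
    have hs₁ : s₁' = Sum.inr b₁ := by
      rcases h₁ with ⟨h, -⟩ | ⟨h, -⟩
      · rw [h, step_inr]
      · exact h
    subst hs₁
    rcases h₀ with ⟨rfl, he₀⟩ | ⟨rfl, rfl⟩
    · by_cases hb : c₀.val.bodd = b₁
      · have hm' : m = Query.bit := by simp [hm, State.msg, reply, hb]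
        simp only [hm', step, Inv]
        exact ⟨hc.resolve_left (not_not.mpr hb), by omega⟩
      · have hm' : m = Query.parity := by simp [hm, State.msg, reply, hb]
        simp only [hm', step, Inv]
        exact ⟨hb, by omega⟩
    · exact ⟨hc, hg₀⟩
  · have hl₁ := c₁.2
    obtain ⟨hc, hg₁⟩ := h
    have hs₀ : s₀' = Sum.inr b₀ := by
      rcases h₀ with ⟨h, -⟩ | ⟨h, -⟩
      · rw [h, step_inr]
      · exact h
    subst hs₀
    rcases h₁ with ⟨rfl, he₁⟩ | ⟨rfl, rfl⟩
    · by_cases hb : c₁.val.bodd = b₀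
      · have hm' : m = Query.bit := by simp [hm, State.msg, reply, hb]
        simp only [hm', step, Inv]
        exact ⟨(hc.resolve_left (not_not.mpr hb)).symm, by omega⟩
      · have hm' : m = Query.parity := by simp [hm, State.msg, reply, hb]
        simp only [hm', step, Inv]
        exact ⟨Ne.symm hb, by omega⟩
    · exact ⟨hc, hg₁⟩
  · obtain ⟨rfl, rfl⟩ := hne b₀ b₁ rfl rfl
    have hs₀ : s₀' = Sum.inr b₀ := by
      rcases h₀ with ⟨h, -⟩ | ⟨h, -⟩
      · rw [h, step_inr]
      · exact h
    have hs₁ : s₁' = Sum.inr b₁ := by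
      rcases h₁ with ⟨h, -⟩ | ⟨h, -⟩
      · rw [h, step_inr]
      · exact h
    subst hs₀ hs₁
    exact h

end Invariant

/-! ### Executions in blocks -/

/-- Alice's state at the start of block `j`, given the symbols `f t` that she receives in the
rounds `t`. A block has `8 K` rounds in which Alice speaks, followed by `3 K` rounds in which Bob
speaks. -/
noncomputable def aliceState {n : ℕ} (K : ℕ) (x : Fin n → Bool) (f : ℕ → Option Bool) :
    ℕ → State n
  | 0 => Sum.inl 0
  | j + 1 => step x (heard K fun r => f (11 * K * j + (8 * K + r))) (aliceState K x f j)

/-- The order of speaking. -/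
def schedule (K t : ℕ) : Party :=
  if t % (11 * K) < 8 * K then Party.alice else Party.bob

/-- The protocol with `T` blocks of `11 K` rounds each, and with an arbitrary output of Bob. -/
noncomputable def blockProtocol {n : ℕ} (K T : ℕ) (code : Msg n → ℕ → Bool)
    (out : List (Option Bool) → Fin n → Bool) : Protocol n where
  rounds := 11 * K * T
  speaker := schedule K
  aliceBit x t l :=
    code ((aliceState K x (received (schedule K) Party.alice l) (t / (11 * K))).msg x)
      (t % (11 * K))
  bobBit t l :=
    (query code (8 * K) fun r =>
      received (schedule K) Party.bob l (11 * K * (t / (11 * K)) + r)).word (t % (11 * K) - 8 * K)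
  bobOutput := out

theorem schedule_alice {K r : ℕ} (j : ℕ) (hr : r < 8 * K) :
    schedule K (11 * K * j + r) = Party.alice := by
  rw [schedule, Nat.mul_add_mod, Nat.mod_eq_of_lt (by omega), if_pos hr]

theorem schedule_bob {K r : ℕ} (j : ℕ) (hr : r < 3 * K) :
    schedule K (11 * K * j + (8 * K + r)) = Party.bob := by
  rw [schedule, Nat.mul_add_mod, Nat.mod_eq_of_lt (by omega), if_neg (by omega)]

theorem heard_congr {K : ℕ} {f f' : ℕ → Option Bool} (h : ∀ r < 3 * K, f r = f' r) :
    heard K f = heard K f' := by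
  have : Fits (3 * K) f = Fits (3 * K) f' := funext fun w =>
    propext (forall₂_congr fun r hr => by rw [h r hr])
  unfold heard
  rw [this]

theorem query_congr {n : ℕ} (code : Msg n → ℕ → Bool) {len : ℕ} {f f' : ℕ → Option Bool}
    (h : ∀ r < len, f r = f' r) : query code len f = query code len f' := by
  have : Fits len f = Fits len f' := funext fun w =>
    propext (forall₂_congr fun r hr => by rw [h r hr])
  unfold query
  rw [this]

theorem aliceState_congr {n K : ℕ} (x : Fin n → Bool) {f f' : ℕ → Option Bool} {j : ℕ}
    (h : ∀ t < 11 * K * j, schedule K t = Party.bob → f t = f' t) :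
    aliceState K x f j = aliceState K x f' j := by
  induction j with
  | zero => rfl
  | succ j ih =>
    rw [aliceState, aliceState, ih fun t ht => h t (by rw [Nat.mul_succ]; omega)]
    congr 1
    exact heard_congr fun r hr => h _ (by rw [Nat.mul_succ]; omega) (schedule_bob j hr)

theorem Event.erased_iff (e : Event) : e.received = none ↔ e.erased = true := by
  unfold Event.received
  split_ifs <;> simp_all

theorem Event.eq_sent {e : Event} {b : Bool} (h : e.received = some b) : b = e.sent := by
  unfold Event.received at h
  split_ifs at h
  exact (Option.some.inj h).symm

section Run

variable {n K T : ℕ} {code : Msg n → ℕ → Bool} {out : List (Option Bool) → Fin n → Bool}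
  (x : Fin n → Bool) (A : Adversary)

/-- The symbol that arrives in round `t`. -/
noncomputable def arrived (K T : ℕ) (code : Msg n → ℕ → Bool)
    (out : List (Option Bool) → Fin n → Bool) (x : Fin n → Bool) (A : Adversary) (t : ℕ) :
    Option Bool :=
  ((blockProtocol K T code out).event x A t).received

/-- What arrives at Bob is a possibly erased word for Alice's current state. -/
theorem fits_alice (j : ℕ) :
    Fits (8 * K) (fun r => arrived K T code out x A (11 * K * j + r))
      (code ((aliceState K x (arrived K T code out x A) j).msg x)) := by
  intro r hr b hb
  have hdiv : (11 * K * j + r) / (11 * K) = j := by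
    rw [Nat.mul_add_div (by omega), Nat.div_eq_of_lt (by omega), add_zero]
  have hmod : (11 * K * j + r) % (11 * K) = r := by
    rw [Nat.mul_add_mod, Nat.mod_eq_of_lt (by omega)]
  rw [Event.eq_sent hb, Protocol.event_sent_of_alice _ _ _ (schedule_alice j hr)]
  change code (State.msg x (aliceState K x _ _)) _ = _
  rw [hdiv, hmod]
  congr 2
  refine aliceState_congr x fun t ht hs => ?_
  exact received_view_history (blockProtocol K T code out) x A (by omega)
    (by change schedule K t ≠ _; rw [hs]; decide)

/-- What arrives at Alice is a possibly erased word for Bob's current query. -/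
theorem fits_bob (j : ℕ) :
    Fits (3 * K) (fun r => arrived K T code out x A (11 * K * j + (8 * K + r)))
      (query code (8 * K) fun r => arrived K T code out x A (11 * K * j + r)).word := by
  intro r hr b hb
  have hdiv : (11 * K * j + (8 * K + r)) / (11 * K) = j := by
    rw [Nat.mul_add_div (by omega), Nat.div_eq_of_lt (by omega), add_zero]
  have hmod : (11 * K * j + (8 * K + r)) % (11 * K) - 8 * K = r := by
    rw [Nat.mul_add_mod, Nat.mod_eq_of_lt (by omega)]
    omega
  rw [Event.eq_sent hb, Protocol.event_sent_of_bob _ _ _ (schedule_bob j hr)]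
  change (query code (8 * K) _).word _ = _
  rw [hdiv, hmod]
  congr 1
  refine query_congr code fun s hs => ?_
  exact received_view_history (blockProtocol K T code out) x A (by omega)
    (by change schedule K _ ≠ _; rw [schedule_alice j hs]; decide)

theorem sum_range_mul (f : ℕ → ℕ) (C T : ℕ) :
    ∑ t ∈ Finset.range (C * T), f t =
      ∑ j ∈ Finset.range T, ∑ r ∈ Finset.range C, f (C * j + r) := by
  induction T with
  | zero => simp
  | succ T ih => rw [Nat.mul_succ, Finset.sum_range_add, ih, Finset.sum_range_succ]

theorem erasures_eq :
    (blockProtocol K T code out).erasures x A = ∑ j ∈ Finset.range T,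
      (erasedCount (8 * K) (fun r => arrived K T code out x A (11 * K * j + r)) +
        erasedCount (3 * K) (fun r => arrived K T code out x A (11 * K * j + (8 * K + r)))) := by
  rw [Protocol.erasures_eq_sum]
  change ∑ t ∈ Finset.range (11 * K * T), _ = _
  rw [sum_range_mul]
  refine Finset.sum_congr rfl fun j _ => ?_
  rw [show 11 * K = 8 * K + 3 * K by ring, Finset.sum_range_add]
  simp only [erasedCount, Finset.card_filter, arrived, Event.erased_iff]

end Run

/-- Bob cannot confuse two inputs unless in one of the two executions almost all blocks suffer many
erasures. -/
theorem many_erasures {n K T d : ℕ} {code : Msg n → ℕ → Bool}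
    {out : List (Option Bool) → Fin n → Bool} (hdK : d ≤ 4 * K)
    (hconst : ∀ b r, r < 8 * K → code (Sum.inr b) r = b)
    (hcode : ∀ u v, u ≠ v →
      d ≤ ((Finset.range (8 * K)).filter fun r => code u r ≠ code v r).card)
    {x₀ x₁ : Fin n → Bool} (hx : x₀ ≠ x₁) {A₀ A₁ : Adversary}
    (hview : view Party.bob ((blockProtocol K T code out).execution x₀ A₀) =
      view Party.bob ((blockProtocol K T code out).execution x₁ A₁)) :
    3 * d * T ≤ 2 * (blockProtocol K T code out).erasures x₀ A₀ + 3 * d * (n + 1) ∨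
      3 * d * T ≤ 2 * (blockProtocol K T code out).erasures x₁ A₁ + 3 * d * (n + 1) := by
  classical
  set f₀ := arrived K T code out x₀ A₀ with hf₀
  set f₁ := arrived K T code out x₁ A₁ with hf₁
  have hsame : ∀ t < 11 * K * T, schedule K t = Party.alice → f₀ t = f₁ t := by
    intro t ht hs
    have hs' : (blockProtocol K T code out).speaker t ≠ Party.bob := by
      change schedule K t ≠ _
      rw [hs]
      decide
    rw [hf₀, hf₁, arrived, arrived, ← received_view_history _ x₀ A₀ ht hs',
      ← received_view_history _ x₁ A₁ ht hs']
    exact congrArg (fun l => received _ Party.bob l t) hview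
  -- `a` counts the erasures of Alice's bits in a block, the same in both executions, `b₀` and `b₁`
  -- count those of Bob's bits, and `e₀` and `e₁` indicate the good blocks
  let a : ℕ → ℕ := fun j => erasedCount (8 * K) fun r => f₀ (11 * K * j + r)
  let b₀ : ℕ → ℕ := fun j => erasedCount (3 * K) fun r => f₀ (11 * K * j + (8 * K + r))
  let b₁ : ℕ → ℕ := fun j => erasedCount (3 * K) fun r => f₁ (11 * K * j + (8 * K + r))
  let e₀ : ℕ → ℕ := fun j => if 2 * a j < 3 * d ∧ b₀ j < 2 * K then 1 else 0
  let e₁ : ℕ → ℕ := fun j => if 2 * a j < 3 * d ∧ b₁ j < 2 * K then 1 else 0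
  have hblock : ∀ j < T, ∀ r < 8 * K, f₀ (11 * K * j + r) = f₁ (11 * K * j + r) := by
    intro j hj r hr
    refine hsame _ ?_ (schedule_alice j hr)
    have := Nat.mul_le_mul_left (11 * K) (Nat.succ_le_of_lt hj)
    rw [Nat.mul_succ] at this
    omega
  have hinv : ∀ j ≤ T, Inv x₀ x₁ (∑ i ∈ Finset.range j, e₀ i) (∑ i ∈ Finset.range j, e₁ i)
      (aliceState K x₀ f₀ j) (aliceState K x₁ f₁ j) ∧
      3 * d * j ≤ ∑ i ∈ Finset.range j, (2 * (a i + b₀ i) + 3 * d * e₀ i) ∧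
      3 * d * j ≤ ∑ i ∈ Finset.range j, (2 * (a i + b₁ i) + 3 * d * e₁ i) := by
    intro j hj
    induction j with
    | zero =>
      refine ⟨⟨Or.inl ⟨rfl, fun i hi => absurd hi (Nat.not_lt_zero _)⟩, ?_, ?_⟩, ?_, ?_⟩ <;> simp
    | succ j ih =>
      obtain ⟨hI, hs₀, hs₁⟩ := ih (by omega)
      have hne := hI.msg_ne hx
      have hfit₀ := fits_alice (K := K) (T := T) (code := code) (out := out) x₀ A₀ j
      have hfit₁ : Fits (8 * K) (fun r => f₀ (11 * K * j + r))
          (code ((aliceState K x₁ f₁ j).msg x₁)) := fun r hr b hb =>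
        fits_alice (K := K) (T := T) (code := code) (out := out) x₁ A₁ j r hr b
          ((hblock j hj r hr).symm.trans hb)
      have had : d ≤ a j := (hcode _ _ hne).trans (hfit₀.card_ne_le hfit₁)
      set m := query code (8 * K) fun r => f₀ (11 * K * j + r) with hm
      have hm₁ : (query code (8 * K) fun r => f₁ (11 * K * j + r)) = m :=
        query_congr code fun r hr => (hblock j hj r hr).symm
      have hq₀ : Fits (3 * K) (fun r => f₀ (11 * K * j + (8 * K + r))) m.word :=
        fits_bob (K := K) (T := T) (code := code) (out := out) x₀ A₀ j
      have hq₁ : Fits (3 * K) (fun r => f₁ (11 * K * j + (8 * K + r))) m.word :=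
        hm₁ ▸ fits_bob (K := K) (T := T) (code := code) (out := out) x₁ A₁ j
      have he₀ : e₀ j ≤ 1 := by dsimp only [e₀]; split_ifs <;> omega
      have he₁ : e₁ j ≤ 1 := by dsimp only [e₁]; split_ifs <;> omega
      -- either `2 a ≥ 3 d`, or `a ≥ d` and at least `2 K` of Bob's bits are erased, where `4 K ≥ d`
      have hcost₀ : 3 * d ≤ 2 * (a j + b₀ j) + 3 * d * e₀ j := by
        dsimp only [e₀]; split_ifs <;> omega
      have hcost₁ : 3 * d ≤ 2 * (a j + b₁ j) + 3 * d * e₁ j := by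
        dsimp only [e₁]; split_ifs <;> omega
      refine ⟨?_, ?_, ?_⟩
      · have hst₀ : (aliceState K x₀ f₀ (j + 1) = step x₀ m (aliceState K x₀ f₀ j) ∧ e₀ j ≤ 1) ∨
            (aliceState K x₀ f₀ (j + 1) = aliceState K x₀ f₀ j ∧ e₀ j = 0) := by
          by_cases hh : heard K (fun r => f₀ (11 * K * j + (8 * K + r))) = m
          · exact Or.inl ⟨by rw [aliceState, hh], he₀⟩
          · refine Or.inr ⟨by rw [aliceState, (heard_eq_or hq₀).resolve_left hh, step_idle], ?_⟩
            exact if_neg fun hlt => hh (heard_eq hq₀ hlt.2)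
        have hst₁ : (aliceState K x₁ f₁ (j + 1) = step x₁ m (aliceState K x₁ f₁ j) ∧ e₁ j ≤ 1) ∨
            (aliceState K x₁ f₁ (j + 1) = aliceState K x₁ f₁ j ∧ e₁ j = 0) := by
          by_cases hh : heard K (fun r => f₁ (11 * K * j + (8 * K + r))) = m
          · exact Or.inl ⟨by rw [aliceState, hh], he₁⟩
          · refine Or.inr ⟨by rw [aliceState, (heard_eq_or hq₁).resolve_left hh, step_idle], ?_⟩
            exact if_neg fun hlt => hh (heard_eq hq₁ hlt.2)
        rw [Finset.sum_range_succ, Finset.sum_range_succ]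
        rcases query_eq_or hcode hne hfit₀ hfit₁ with hr | ⟨hidle, had3⟩
        · refine hI.next hx hr (fun b b' hb hb' => ?_) hst₀ hst₁
          -- two different constant words both fit only if everything is erased
          have hall : 8 * K ≤ a j := by
            rw [hb] at hfit₀ hI
            rw [hb'] at hfit₁ hI
            have := hfit₀.card_ne_le hfit₁
            rwa [Finset.filter_true_of_mem, Finset.card_range] at this
            intro r hr
            rw [Finset.mem_range] at hr
            change code (Sum.inr b) r ≠ code (Sum.inr b') r
            rw [hconst b r hr, hconst b' r hr]
            exact hI.1
          exact ⟨if_neg (by omega), if_neg (by omega)⟩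
        · have h3 : 3 * d ≤ 2 * a j := had3
          have hm' : m = Query.idle := hidle
          rw [hm', step_idle] at hst₀ hst₁
          rw [show e₀ j = 0 from if_neg (by omega), show e₁ j = 0 from if_neg (by omega),
            hst₀.elim And.left And.left, hst₁.elim And.left And.left]
          exact hI
      · rw [Finset.sum_range_succ, Nat.mul_succ]
        exact Nat.add_le_add hs₀ hcost₀
      · rw [Finset.sum_range_succ, Nat.mul_succ]
        exact Nat.add_le_add hs₁ hcost₁
  obtain ⟨hI, hs₀, hs₁⟩ := hinv T le_rfl
  rw [Finset.sum_add_distrib, ← Finset.mul_sum, ← Finset.mul_sum] at hs₀ hs₁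
  have hE₀ : (blockProtocol K T code out).erasures x₀ A₀ =
      ∑ j ∈ Finset.range T, (a j + b₀ j) := erasures_eq x₀ A₀
  have hE₁ : (blockProtocol K T code out).erasures x₁ A₁ =
      ∑ j ∈ Finset.range T, (a j + b₁ j) := by
    rw [erasures_eq]
    refine Finset.sum_congr rfl fun j hj => ?_
    congr 1
    have := hblock j (Finset.mem_range.mp hj)
    exact congrArg Finset.card (Finset.filter_congr fun r hr => by
      change f₁ _ = none ↔ f₀ _ = none
      rw [this r (Finset.mem_range.mp hr)])
  rw [hE₀, hE₁]
  rcases hI.le_or_le with h | h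
  · exact Or.inl (hs₀.trans (by gcongr))
  · exact Or.inr (hs₁.trans (by gcongr))

/-! ### Bob's output and the choice of parameters -/

/-- Bob's output has no influence on the course of the execution. -/
theorem history_blockProtocol {n K T : ℕ} {code : Msg n → ℕ → Bool}
    (out out' : List (Option Bool) → Fin n → Bool) (x : Fin n → Bool) (A : Adversary) (t : ℕ) :
    (blockProtocol K T code out).history x A t = (blockProtocol K T code out').history x A t := by
  induction t with
  | zero => rfl
  | succ t ih =>
    rw [Protocol.history, Protocol.history, ih]
    rfl

open Classical in
/-- If no two inputs can be confused within a budget of `B` erasures, then Bob can output an input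
for which some attack within the budget explains what he has received. -/
theorem exists_output {n K T : ℕ} {code : Msg n → ℕ → Bool} {B : ℝ}
    (h : ∀ (out : List (Option Bool) → Fin n → Bool) (x₀ x₁ : Fin n → Bool) (A₀ A₁ : Adversary),
      ((blockProtocol K T code out).erasures x₀ A₀ : ℝ) ≤ B →
      ((blockProtocol K T code out).erasures x₁ A₁ : ℝ) ≤ B →
      view Party.bob ((blockProtocol K T code out).execution x₀ A₀) =
        view Party.bob ((blockProtocol K T code out).execution x₁ A₁) → x₀ = x₁) :
    ∃ out : List (Option Bool) → Fin n → Bool, ∀ (x : Fin n → Bool) (A : Adversary),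
      ((blockProtocol K T code out).erasures x A : ℝ) ≤ B →
        (blockProtocol K T code out).result x A = x := by
  let out₀ : List (Option Bool) → Fin n → Bool := fun _ _ => false
  let π := blockProtocol K T code out₀
  let P : List (Option Bool) → (Fin n → Bool) → Prop := fun l y =>
    ∃ A : Adversary, (π.erasures y A : ℝ) ≤ B ∧ view Party.bob (π.execution y A) = l
  let out : List (Option Bool) → Fin n → Bool := fun l =>
    if hl : ∃ y, P l y then hl.choose else fun _ => false
  refine ⟨out, fun x A hA => ?_⟩
  have hex : (blockProtocol K T code out).execution x A = π.execution x A :=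
    history_blockProtocol out out₀ x A _
  rw [Protocol.erasures, hex] at hA
  change out (view Party.bob ((blockProtocol K T code out).execution x A)) = x
  rw [hex]
  have hl : ∃ y, P (view Party.bob (π.execution x A)) y := ⟨x, A, hA, rfl⟩
  obtain ⟨A', hA', hv⟩ := hl.choose_spec
  rw [show out (view Party.bob (π.execution x A)) = hl.choose from dif_pos hl]
  exact h out₀ _ _ A' A hA' hA hv

/-- With `q (n + 1)` blocks of `88 q² (n + 1)` rounds each, a fraction of `6 / 11 - 1 / q` of
erasures can be tolerated. -/
theorem exists_protocol (n q : ℕ) (hq : 0 < q) : ∃ π : Protocol n,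
    π.rounds = 88 * q ^ 3 * (n + 1) ^ 2 ∧ ∀ (x : Fin n → Bool) (A : Adversary),
      (π.erasures x A : ℝ) ≤ (6 / 11 - 1 / q) * π.rounds → π.result x A = x := by
  set k := 8 * q * (n + 1) with hk
  have hkq : k ≤ 4 * (q * k) := (Nat.le_mul_of_pos_left k hq).trans (by omega)
  obtain ⟨d, hd⟩ : ∃ d, d + k = 4 * (q * k) := ⟨4 * (q * k) - k, by omega⟩
  obtain ⟨code, hconst, hcode⟩ := exists_msgCode n q k d hq hk hd
  set K := q * k with hK
  set T := q * (n + 1) with hT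
  have hrounds : 11 * K * T = 88 * q ^ 3 * (n + 1) ^ 2 := by rw [hK, hT, hk]; ring
  have hqR : (0 : ℝ) < q := by exact_mod_cast hq
  have hkR : (0 : ℝ) < k := by rw [hk]; push_cast; positivity
  have hlt : ∀ E : ℕ, (E : ℝ) ≤ (6 / 11 - 1 / q) * (11 * K * T : ℕ) →
      2 * E + 3 * d * (n + 1) < 3 * d * T := by
    intro E hE
    have hdR : (d : ℝ) = 4 * (q * k) - k := by
      have : (d : ℝ) + k = 4 * (q * k) := by exact_mod_cast hd
      linarith
    have hbudget : (6 / 11 - 1 / q) * ((11 * K * T : ℕ) : ℝ) =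
        (6 * q - 11) * (q * (k * (n + 1))) := by
      rw [hK, hT]
      push_cast
      field_simp
    have hpos : (0 : ℝ) < k * (n + 1) := by positivity
    have hgap : (3 * d * T : ℝ) - 3 * d * (n + 1) - 2 * ((6 * q - 11) * (q * (k * (n + 1)))) =
        (7 * q + 3) * (k * (n + 1)) := by
      rw [hdR, hT]
      push_cast
      ring
    have hgap' : (0 : ℝ) < (7 * q + 3) * (k * (n + 1)) := by positivity
    rw [hbudget] at hE
    have : ((2 * E + 3 * d * (n + 1) : ℕ) : ℝ) < ((3 * d * T : ℕ) : ℝ) := by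
      push_cast at hgap ⊢
      linarith
    exact_mod_cast this
  obtain ⟨out, hout⟩ := exists_output (n := n) (K := K) (T := T) (code := code)
    (B := (6 / 11 - 1 / q) * (11 * K * T : ℕ)) (by
      intro out x₀ x₁ A₀ A₁ h₀ h₁ hview
      by_contra hx
      have h₀' := hlt _ h₀
      have h₁' := hlt _ h₁
      rcases many_erasures (by omega) hconst hcode hx hview with h | h <;> omega)
  exact ⟨blockProtocol K T code out, hrounds, fun x A hA => hout x A hA⟩

end ErasureChannel

theorem mainTheorem2 (ε : ℝ) (hε : 0 < ε) :
    ∃ π : ErasureChannel.IECC,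
      π.ResilientToErasures (6 / 11 - ε) ∧
      (fun n : ℕ => ((π n).rounds : ℝ)) =O[atTop] (fun n : ℕ => (n : ℝ) ^ 2) := by
  obtain ⟨p, hp⟩ := exists_nat_one_div_lt hε
  choose π hrounds hπ using fun n => ErasureChannel.exists_protocol n (p + 1) p.succ_pos
  refine ⟨π, ⟨0, fun n _ x A hA => hπ n x A (hA.trans ?_)⟩, ?_⟩
  · push_cast
    gcongr
  · refine IsBigO.of_bound (88 * ((p : ℝ) + 1) ^ 3 * 4) ?_
    filter_upwards [eventually_ge_atTop 1] with n hn
    have hn' : (1 : ℝ) ≤ n := by exact_mod_cast hn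
    rw [hrounds, Real.norm_of_nonneg (by positivity), Real.norm_of_nonneg (by positivity)]
    push_cast
    rw [mul_assoc (88 * ((p : ℝ) + 1) ^ 3)]
    gcongr
    nlinarith
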